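/- **Setting.** Let $\mathcal G_{n,d,q}$ be the set of graphs $G$ with vertex set $\{1,\dots,n\}$ and maximum degree at most $q$, each vertex $v$ carrying a one-hot feature $a_G(v)\in\{e_1,\dots,e_d\}\subset\mathbb R^d$, where $n,d\ge 1$. *Forest distance.* For $L\in\mathbb N$, the unrolling tree of depth $L$ at $u\in V(G)$ has as its vertices the walks of length at most $L$ in $G$ starting at $u$, a walk being a child of the walk obtained by deleting its last step, and labeled by the feature of its last vertex. Let $F_{G,L}$ be the disjoint union over $u$ of these $n$ trees, padded with vertices labeled $0\in\mathbb R^d$ such that every vertex at a level below $L$ has exactly $n-1$ children. Let $$\mathrm{FD}_L(G,H)=\min_{\theta}\sum_{s\in V(F_{G,L})}\|\mathrm{label}_G(s)-\mathrm{label}_H(\theta(s))\|_2,$$ the minimum being over all bijections $\theta:V(F_{G,L})\to V(F_{H,L})$ that preserve parent–child edges. $\mathcal N(\mathcal G_{n,d,q},\mathrm{FD}_L,\varepsilon)$ is the least cardinality of a set $C\subseteq\mathcal G_{n,d,q}$ such that every $G\in\mathcal G_{n,d,q}$ satisfies $\mathrm{FD}_L(G,H)\le\varepsilon$ for some $H\in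 C$. *Networks.* Fix $L$ and constants $L_{\varphi_t}>0$, $\omega^{(1)}_t,\omega^{(2)}_t,\beta_t\ge 0$ for $t=1,\dots,L$. Given $\sigma:\mathbb R\to\mathbb R$, $L_\psi,L_{\mathsf{FNN}}>0$ and $M'\in\mathbb R$, the class $\mathsf{MPNN}^{\mathrm{sum}}_{L,M',L_{\mathsf{FNN}}}(\mathcal G_{n,d,q})$ consists of the maps $h(G)=\mathsf{FNN}(\mathbf h_G)$ with $$\mathbf h_v^{(0)}=a_G(v),\quad \mathbf h_v^{(t)}=\varphi_t\Big(\mathbf h_v^{(t-1)}W_t^{(1)}+\sum_{u\in N(v)}\mathbf h_u^{(t-1)}W_t^{(2)}\Big),\quad \mathbf h_G=\psi\Big(\tfrac1n\sum_v\mathbf h_v^{(L)}\Big),$$ of arbitrary widths, where (for Euclidean norms) $\varphi_t$ is $L_{\varphi_t}$-Lipschitz with $\|\varphi_t(0)\|_2\le\beta_t$, the matrices satisfy $\|W_t^{(i)}\|_2\le\omega_t^{(i)}$ (spectral norm), $\psi$ is $L_\psi$-Lipschitz, $\mathsf{FNN}(x)=\sigma(\cdots\sigma(\sigma(xW_1)W_2)\cdots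 w)$ is a real-valued feed-forward network of any depth with activation $\sigma$ (applied componentwise) and square weight matrices $W_1,W_2,\dots$ before the last, one-column matrix $w$, which is $L_{\mathsf{FNN}}$-Lipschitz, and $|h|\le M'$ on $\mathcal G_{n,d,q}$. *Learning.* Let $\mathcal Z=\mathcal G_{n,d,q}\times\{0,1\}$ and let $\ell(x,y)=-\big(y\log s(x)+(1-y)\log(1-s(x))\big)$, $s(x)=1/(1+e^{-x})$, be the cross-entropy loss, and let $L_\ell$ be a Lipschitz constant of $\ell(\cdot,y)$ for both $y\in\{0,1\}$. A learning algorithm for a class $\mathcal H$ assigns to each finite sample $\mathcal S$ of $\mathcal Z$ some $h_{\mathcal S}\in\mathcal H$. It is $(K,\eta)$-robust if for each $\mathcal S$, $\mathcal Z$ can be partitioned into $K>0$ non-empty cells such that $|\ell(h_{\mathcal S}(G),y)-\ell(h_{\mathcal S}(G'),y')|<\eta$ for all $(G,y),(G',y')$ in the same cell. For a probability distribution $\mu$ on $\mathcal Z$, put $\ell_{\exp}(h)=\mathbb E_{(G,y)\sim\mu}[\ell(h(G),y)]$ and $\ell_{\mathrm{emp}}(h)=\frac1{|\mathcal S|}\sum_{(G,y)\in\mathcal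 S}\ell(h(G),y)$. **Proposition.** For every $L$ and all constants $L_{\varphi_t}>0$, $\omega_t^{(1)},\omega_t^{(2)},\beta_t\ge 0$ $(t=1,\dots,L)$ there is a constant $C>0$, depending only on these, such that, with $C_{\mathrm{FD}_L}=C\,L_\psi\prod_{t=1}^L L_{\varphi_t}$, the following holds for all $\sigma$, $L_\psi,L_{\mathsf{FNN}}>0$, $M'\in\mathbb R$, $n,d\ge 1$, $q\ge0$, all $L_\ell$ as above, all $\varepsilon>0$, and every learning algorithm for $\mathsf{MPNN}^{\mathrm{sum}}_{L,M',L_{\mathsf{FNN}}}(\mathcal G_{n,d,q})$. 1. The algorithm is $\big(2\,\mathcal N(\mathcal G_{n,d,q},\mathrm{FD}_L,\varepsilon),\ L_\ell L_{\mathsf{FNN}}C_{\mathrm{FD}_L}\cdot 2\varepsilon\big)$-robust. 2. Let $M$ satisfy $|\ell(h(G),y)|\le M$ for all $h$ in the class, $G\in\mathcal G_{n,d,q}$ and $y\in\{0,1\}$, let $\mu$ be a probability distribution on $\mathcal Z$, $\delta\in(0,1)$, and let $\mathcal S$ consist of $|\mathcal S|\ge1$ independent draws from $\mu$. Then, with probability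 at least $1-\delta$, $$|\ell_{\exp}(h_{\mathcal S})-\ell_{\mathrm{emp}}(h_{\mathcal S})|\le\widetilde C\,\varepsilon+M\sqrt{\frac{4\,\mathcal N(\mathcal G_{n,d,q},\mathrm{FD}_L,\varepsilon)\log 2+2\log(1/\delta)}{|\mathcal S|}},\qquad \widetilde C=\tfrac2n L_\ell L_{\mathsf{FNN}}C_{\mathrm{FD}_L}.$$ -/

import Mathlib

open Set MeasureTheory Metric
open scoped NNReal

noncomputable section

/-! ### Graphs -/

/-- Attributed graphs of order `n` (with vertex set `Fin n`) and features in `ℝ^d`. -/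
structure AttrGraph (n d : ℕ) where
  graph : SimpleGraph (Fin n)
  attr : Fin n → EuclideanSpace ℝ (Fin d)

/-- The set `𝒢_{n,d,q}` of `n`-order graphs of maximum degree at most `q` whose vertices carry
one-hot encoded labels out of `d` possible labels. -/
def boundedGraphs (n d q : ℕ) : Set (AttrGraph n d) :=
  {G | (∀ v, ∃ i, G.attr v = EuclideanSpace.single i 1) ∧
    ∀ v, (G.graph.neighborSet v).ncard ≤ q}

/-- `𝒢_{n,d,q}` as a type, with the discrete `σ`-algebra (the type is finite). -/
abbrev BoundedGraph (n d q : ℕ) : Type := {G : AttrGraph n d // G ∈ boundedGraphs n d q}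

instance (n d q : ℕ) : MeasurableSpace (BoundedGraph n d q) := ⊤

/-! ### The Forest distance -/

/-- The vertices of the padded forest `F_{G,L}`: a vertex at level `l ≤ L` of the tree with root
`v₀` is the list `[v_l, …, v₁, v₀]`, where consecutive entries are distinct. Every vertex at a level
below `L` thus has exactly `n - 1` children. For `G` on `Fin n`, the lists which are walks in `G` are
the vertices of the unrolling trees `unr(G, v₀, L)`; all the other ones are padding. -/
def ForestVertex (n L : ℕ) : Type :=
  {s : List (Fin n) // s ≠ [] ∧ s.length ≤ L + 1 ∧ s.IsChain (· ≠ ·)}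

/-- `ForestChild s t`: in the forest, the vertex `s` is a child of the vertex `t`. -/
def ForestChild {n L : ℕ} (s t : ForestVertex n L) : Prop := ∃ v, s.1 = v :: t.1

instance (n L : ℕ) : Finite (ForestVertex n L) :=
  ((List.finite_length_le (Fin n) (L + 1)).subset (fun _ h => h.2.1) :
    {s : List (Fin n) | s ≠ [] ∧ s.length ≤ L + 1 ∧ s.IsChain (· ≠ ·)}.Finite).to_subtype

instance (n L : ℕ) : Fintype (ForestVertex n L) := Fintype.ofFinite _

instance (n L : ℕ) : Finite (@ForestChild n L ≃r @ForestChild n L) :=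
  Finite.of_injective _ RelIso.toEquiv_injective

open Classical in
/-- The label of a vertex of the padded forest `F_{G,L}`: a vertex of an unrolling tree, i.e. a walk
in `G`, has the feature of the last vertex reached by the walk, and padding vertices have label
`0`. -/
def forestLabel {n d L : ℕ} (G : AttrGraph n d) (s : ForestVertex n L) :
    EuclideanSpace ℝ (Fin d) :=
  if s.1.IsChain G.graph.Adj then G.attr (s.1.head s.2.1) else 0

/-- The cost of an edge-preserving bijection `θ` between the padded forests of `G` and `H`. -/
def forestCost {n d L : ℕ} (G H : AttrGraph n d) (θ : @ForestChild n L ≃r @ForestChild n L) : ℝ :=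
  ∑ s : ForestVertex n L, ‖forestLabel G s - forestLabel H (θ s)‖

/-- The Forest distance `FD_L(G, H)`: the minimal cost of a bijection between the vertices of the
padded forests that preserves the (parent, child) edges. The infimum is over a finite non-empty
type. -/
def forestDist {n d : ℕ} (L : ℕ) (G H : AttrGraph n d) : ℝ :=
  ⨅ θ : @ForestChild n L ≃r @ForestChild n L, forestCost G H θ

theorem forestDist_le {n d L : ℕ} (G H : AttrGraph n d)
    (θ : @ForestChild n L ≃r @ForestChild n L) : forestDist L G H ≤ forestCost G H θ :=
  ciInf_le (Set.finite_range _).bddBelow θ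

theorem exists_forestDist_eq {n d : ℕ} (L : ℕ) (G H : AttrGraph n d) :
    ∃ θ : @ForestChild n L ≃r @ForestChild n L, forestCost G H θ = forestDist L G H :=
  haveI : Nonempty (@ForestChild n L ≃r @ForestChild n L) := ⟨RelIso.refl _⟩
  exists_eq_ciInf_of_finite

theorem forestCost_nonneg {n d L : ℕ} (G H : AttrGraph n d)
    (θ : @ForestChild n L ≃r @ForestChild n L) : 0 ≤ forestCost G H θ :=
  Finset.sum_nonneg fun _ _ => norm_nonneg _

theorem forestCost_symm {n d L : ℕ} (G H : AttrGraph n d)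
    (θ : @ForestChild n L ≃r @ForestChild n L) : forestCost H G θ.symm = forestCost G H θ := by
  unfold forestCost
  rw [← Equiv.sum_comp θ.toEquiv]
  refine Finset.sum_congr rfl fun s _ => ?_
  rw [norm_sub_rev]
  simp

theorem forestCost_trans_le {n d L : ℕ} (G H K : AttrGraph n d)
    (θ η : @ForestChild n L ≃r @ForestChild n L) :
    forestCost G K (θ.trans η) ≤ forestCost G H θ + forestCost H K η := by
  have h : forestCost H K η =
      ∑ s : ForestVertex n L, ‖forestLabel H (θ s) - forestLabel K (η (θ s))‖ :=
    (Equiv.sum_comp θ.toEquiv fun s => ‖forestLabel H s - forestLabel K (η s)‖).symm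
  rw [h, forestCost, forestCost, ← Finset.sum_add_distrib]
  exact Finset.sum_le_sum fun s _ => norm_sub_le_norm_sub_add_norm_sub _ _ _

/-- The Forest distance `FD_L` is a pseudo-metric on attributed graphs of order `n`. -/
@[reducible] def forestPseudoMetric (n d L : ℕ) : PseudoMetricSpace (AttrGraph n d) where
  dist := forestDist L
  dist_self G := by
    refine le_antisymm ((forestDist_le G G (RelIso.refl _)).trans ?_) ?_
    · simp [forestCost]
    · obtain ⟨θ, h⟩ := exists_forestDist_eq L G G
      exact h ▸ forestCost_nonneg G G θ
  dist_comm G H := by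
    have key : ∀ G H : AttrGraph n d, forestDist L G H ≤ forestDist L H G := fun G H => by
      obtain ⟨θ, h⟩ := exists_forestDist_eq L H G
      rw [← h, ← forestCost_symm]
      exact forestDist_le G H θ.symm
    exact le_antisymm (key G H) (key H G)
  dist_triangle G H K := by
    obtain ⟨θ, hθ⟩ := exists_forestDist_eq L G H
    obtain ⟨η, hη⟩ := exists_forestDist_eq L H K
    rw [← hθ, ← hη]
    exact (forestDist_le G K (θ.trans η)).trans (forestCost_trans_le G H K θ η)

/-- The covering number `𝒩(𝒢_{n,d,q}, FD_L, ε)` as a natural number (it is finite, since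
`𝒢_{n,d,q}` is). -/
def forestCoveringNumber (n d q L : ℕ) (ε : ℝ≥0) : ℕ :=
  letI := forestPseudoMetric n d L
  (coveringNumber ε (boundedGraphs n d q)).toNat

theorem finite_boundedGraphs (n d q : ℕ) : (boundedGraphs n d q).Finite := by
  refine (Set.finite_range fun p : SimpleGraph (Fin n) × (Fin n → Fin d) =>
    (⟨p.1, fun v => EuclideanSpace.single (p.2 v) 1⟩ : AttrGraph n d)).subset ?_
  rintro ⟨g, a⟩ ⟨h, -⟩
  choose c hc using h
  exact ⟨(g, c), by simp only [AttrGraph.mk.injEq, true_and]; exact funext fun v => (hc v).symm⟩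

theorem coe_forestCoveringNumber (n d q L : ℕ) (ε : ℝ≥0) :
    letI := forestPseudoMetric n d L
    (forestCoveringNumber n d q L ε : ℕ∞) = coveringNumber ε (boundedGraphs n d q) := by
  let _ := forestPseudoMetric n d L
  exact ENat.natCast_toNat (ne_top_of_le_ne_top (finite_boundedGraphs n d q).encard_lt_top.ne
    (coveringNumber_le_encard_self _))

/-! ### Message-passing networks with sum aggregation -/

/-- The product `x W` of a row vector and a matrix, between Euclidean spaces. -/
def rowMul {m k : ℕ} (W : Matrix (Fin m) (Fin k) ℝ) (x : EuclideanSpace ℝ (Fin m)) :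
    EuclideanSpace ℝ (Fin k) :=
  WithLp.toLp 2 (Matrix.vecMul x.ofLp W)

/-- The feed-forward network `x ↦ σ(⋯ σ(σ(x W₁) W₂) ⋯ w)` with activation `σ`, applied
componentwise; `Ws` is the list of the square matrices `W₁, W₂, …` and `w` is the last, one-column
matrix. -/
def fnn (σ : ℝ → ℝ) {p : ℕ} (Ws : List (Matrix (Fin p) (Fin p) ℝ)) (w : Fin p → ℝ)
    (x : EuclideanSpace ℝ (Fin p)) : ℝ :=
  σ (Ws.foldl (fun y W => fun j => σ (Matrix.vecMul y W j)) x.ofLp ⬝ᵥ w)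

/-- The feature dimension after `t` layers, for input dimension `d`. -/
def layerDim (d : ℕ) (width : ℕ → ℕ) : ℕ → ℕ
  | 0 => d
  | t + 1 => width t

/-- The data of an `L`-layer message-passing network with sum aggregation and input dimension `d`.
Layers are numbered from `0`; only the layers `t < L` matter. -/
structure SumMPNN (L d : ℕ) where
  /-- the output dimension of each layer -/
  width : ℕ → ℕ
  /-- the matrix applied to the feature of the vertex itself -/
  W₁ : ∀ t, Matrix (Fin (layerDim d width t)) (Fin (width t)) ℝ
  /-- the matrix applied to the features of the neighbours -/
  W₂ : ∀ t, Matrix (Fin (layerDim d width t)) (Fin (width t)) ℝ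
  /-- the non-linear maps of the layers -/
  φ : ∀ t, EuclideanSpace ℝ (Fin (width t)) → EuclideanSpace ℝ (Fin (width t))
  /-- the dimension of the graph representation -/
  outDim : ℕ
  /-- the readout map -/
  ψ : EuclideanSpace ℝ (Fin (layerDim d width L)) → EuclideanSpace ℝ (Fin outDim)
  /-- the square weight matrices of the final feed-forward network -/
  Ws : List (Matrix (Fin outDim) (Fin outDim) ℝ)
  /-- the last weight matrix of the final feed-forward network -/
  w : Fin outDim → ℝ

namespace SumMPNN

variable {L d n : ℕ}

open Classical in
/-- The vertex features: `h_v^{(0)} = a(v)` and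
`h_v^{(t+1)} = φ_t (h_v^{(t)} W₁_t + ∑_{u ∈ N(v)} h_u^{(t)} W₂_t)`. -/
def feature (N : SumMPNN L d) (G : AttrGraph n d) :
    (t : ℕ) → Fin n → EuclideanSpace ℝ (Fin (layerDim d N.width t))
  | 0 => G.attr
  | t + 1 => fun v => N.φ t (rowMul (N.W₁ t) (feature N G t v) +
      ∑ u with G.graph.Adj v u, rowMul (N.W₂ t) (feature N G t u))

/-- The graph representation `h_G = ψ ((1/n) ∑_v h_v^{(L)})`. -/
def readout (N : SumMPNN L d) (G : AttrGraph n d) : EuclideanSpace ℝ (Fin N.outDim) :=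
  N.ψ ((1 / (n : ℝ)) • ∑ v, N.feature G L v)

/-- The real-valued output `FNN(h_G)`. -/
def output (N : SumMPNN L d) (σ : ℝ → ℝ) (G : AttrGraph n d) : ℝ :=
  fnn σ N.Ws N.w (N.readout G)

end SumMPNN

/-- Bounds on the message-passing layers which are shared by all networks of a class. -/
structure LayerBounds (L : ℕ) where
  /-- Lipschitz constant of `φ_t` -/
  Lφ : Fin L → ℝ≥0
  /-- Lipschitz constant of `x ↦ x W₁_t`, i.e. bound on the spectral norm of `W₁_t` -/
  ω₁ : Fin L → ℝ≥0
  /-- Lipschitz constant of `x ↦ x W₂_t`, i.e. bound on the spectral norm of `W₂_t` -/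
  ω₂ : Fin L → ℝ≥0
  /-- bound on the norm of the offset `φ_t(0)` -/
  β : Fin L → ℝ≥0

/-- The class `MPNN^sum_{L,M',L_FNN}(𝒢_{n,d,q})` of `L`-layer sum-aggregation networks with
activation `σ`, whose layers obey the bounds `B`, whose readout map `ψ` is `Lψ`-Lipschitz, and whose
final feed-forward network is `LF`-Lipschitz and has outputs bounded by `M'`. -/
def sumMPNNClass (L : ℕ) (B : LayerBounds L) (σ : ℝ → ℝ) (Lψ LF : ℝ≥0) (M' : ℝ) (n d q : ℕ) :
    Set (BoundedGraph n d q → ℝ) :=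
  {h | ∃ N : SumMPNN L d,
    (∀ t : Fin L, LipschitzWith (B.Lφ t) (N.φ t) ∧ LipschitzWith (B.ω₁ t) (rowMul (N.W₁ t)) ∧
      LipschitzWith (B.ω₂ t) (rowMul (N.W₂ t)) ∧ ‖N.φ t 0‖ ≤ B.β t) ∧
    LipschitzWith Lψ N.ψ ∧ LipschitzWith LF (fnn σ N.Ws N.w) ∧
    (∀ G : BoundedGraph n d q, |N.output σ G.1| ≤ M') ∧
    h = fun G => N.output σ G.1}

/-! ### Learning -/

/-- A finite sample of elements of `Z`. -/
abbrev Sample (Z : Type*) : Type _ := Σ m : ℕ, Fin m → Z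

/-- A learning algorithm for a class `H` of maps `X → V` on `X × Y` returns an element of `H` for
every sample. -/
abbrev LearningAlgorithm {X V : Type*} (Y : Type*) (H : Set (X → V)) : Type _ :=
  Sample (X × Y) → H

/-- `(K, ε)`-robustness: for every sample `S`, the set `X × Y` can be partitioned into `K S > 0`
cells such that the losses of the returned map at any two points of the same cell differ by less
than `ε S`. -/
def IsRobust {X V Y : Type*} {H : Set (X → V)} (loss : V → Y → ℝ) (A : LearningAlgorithm Y H)
    (K : Sample (X × Y) → ℕ) (ε : Sample (X × Y) → ℝ) : Prop :=
  ∀ S, 0 < K S ∧ ∃ C : Fin (K S) → Set (X × Y),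
    (∀ i, (C i).Nonempty) ∧ Pairwise (Function.onFun Disjoint C) ∧ ⋃ i, C i = univ ∧
    ∀ i, ∀ z ∈ C i, ∀ z' ∈ C i,
      |loss ((A S : X → V) z.1) z.2 - loss ((A S : X → V) z'.1) z'.2| < ε S

/-- The expected error of `h` under the distribution `μ`. -/
def expError {X V Y : Type*} [MeasurableSpace X] [MeasurableSpace Y] (loss : V → Y → ℝ)
    (μ : Measure (X × Y)) (h : X → V) : ℝ :=
  ∫ z, loss (h z.1) z.2 ∂μ

/-- The empirical error of `h` on the sample `S` of size `m`. -/
def empError {X V Y : Type*} (loss : V → Y → ℝ) {m : ℕ} (S : Fin m → X × Y) (h : X → V) : ℝ :=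
  (1 / (m : ℝ)) * ∑ i, loss (h (S i).1) (S i).2

/-- The binary cross-entropy loss of the score `x` for the label `y ∈ {0, 1}`. -/
def crossEntropy (x : ℝ) (y : Fin 2) : ℝ :=
  -(((y : ℕ) : ℝ) * Real.log (Real.sigmoid x) +
    (1 - ((y : ℕ) : ℝ)) * Real.log (1 - Real.sigmoid x))

/-- The constant `C_FD = C · L_ψ · ∏ₜ L_{φ_t}`. -/
def forestLipschitzConst {L : ℕ} (B : LayerBounds L) (C : ℝ) (Lψ : ℝ≥0) : ℝ :=
  C * Lψ * ∏ t, (B.Lφ t : ℝ)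

end

/-! ### Lipschitz continuity of the networks with respect to the Forest distance -/

/-! Every network of the class is Lipschitz for the Forest distance. A vertex feature after `t`
layers depends only on the unrolling tree of depth `t`, so features can be carried to the padded
forest, with value `0` at padding. For an edge-preserving bijection `θ`, induction on `t` bounds the
feature difference between `s` and `θ s` by a constant times the cost of `θ` on the `t` levels below
`s` (`norm_walkFeature_sub_le`). The delicate case is a walk matched with padding: the offset
`φ_t(0)` then survives, but a one-hot label is compared with `0`, so the cost is at least `1` and
absorbs it. Subtrees at distinct roots are disjoint, so summing over the roots gives at most the
total cost of `θ`; an optimal `θ` gives the Forest distance.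

Robustness follows by grouping graphs around the centres of a minimal `ε`-cover and separating the
two labels: cells have diameter at most `2ε`, so the loss oscillates little on each. The
generalization bound is the Xu–Mannor argument: apart from this oscillation, the error is at most
`M` times the `ℓ¹` deviation of the empirical cell frequencies, which a union bound over sign
patterns and Hoeffding's inequality control. -/

section Forest

variable {n d L : ℕ}

namespace ForestVertex

theorem length_pos (s : ForestVertex n L) : 0 < s.1.length :=
  List.length_pos_of_ne_nil s.2.1

/-- An edge-preserving bijection of the forest preserves the levels. -/
theorem length_apply (θ : @ForestChild n L ≃r @ForestChild n L) (s : ForestVertex n L) :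
    (θ s).1.length = s.1.length := by
  -- One inequality for all bijections suffices, as it also applies to the inverse. The image of a
  -- child is a child of the image of its parent, hence one entry longer.
  have key : ∀ (k : ℕ) (η : @ForestChild n L ≃r @ForestChild n L) (s : ForestVertex n L),
      s.1.length = k → s.1.length ≤ (η s).1.length := by
    intro k
    induction k with
    | zero => intro η s hs; omega
    | succ k ih =>
      intro η s hs
      obtain ⟨_ | ⟨v, l⟩, h0, hlen, hch⟩ := s
      · exact absurd rfl h0
      · by_cases hl : l = []
        · subst hl
          exact (η _).length_pos
        · let t : ForestVertex n L := ⟨l, hl, by simp at hlen; omega, hch.tail⟩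
          have hc : ForestChild ⟨v :: l, h0, hlen, hch⟩ t := ⟨v, rfl⟩
          obtain ⟨u, hu⟩ := η.map_rel_iff.2 hc
          have := ih η t (by simpa using hs)
          rw [hu]
          simpa using this
  refine le_antisymm ?_ (key _ θ s rfl)
  simpa using key _ θ.symm (θ s) rfl

end ForestVertex

open Classical in
/-- The part of the cost of `θ` coming from the vertices at most `t` levels below `s`. -/
noncomputable def subtreeCost (G H : AttrGraph n d) (θ : @ForestChild n L ≃r @ForestChild n L) :
    ℕ → ForestVertex n L → ℝ
  | 0, s => ‖forestLabel G s - forestLabel H (θ s)‖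
  | t + 1, s => ‖forestLabel G s - forestLabel H (θ s)‖ +
      ∑ s' with ForestChild s' s, subtreeCost G H θ t s'

variable (G H : AttrGraph n d) (θ : @ForestChild n L ≃r @ForestChild n L)

theorem subtreeCost_nonneg (t : ℕ) (s : ForestVertex n L) : 0 ≤ subtreeCost G H θ t s := by
  induction t generalizing s with
  | zero => exact norm_nonneg _
  | succ t ih => exact add_nonneg (norm_nonneg _) (Finset.sum_nonneg fun s' _ => ih s')

/-- When a walk is matched with padding the left side is `1`; this is what later absorbs the offset
`φ_t(0)`. -/
theorem label_le_subtreeCost (t : ℕ) (s : ForestVertex n L) :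
    ‖forestLabel G s - forestLabel H (θ s)‖ ≤ subtreeCost G H θ t s := by
  cases t with
  | zero => exact le_rfl
  | succ t =>
    exact le_add_of_nonneg_right (Finset.sum_nonneg fun s' _ => subtreeCost_nonneg G H θ t s')

theorem subtreeCost_le_succ (t : ℕ) (s : ForestVertex n L) :
    subtreeCost G H θ t s ≤ subtreeCost G H θ (t + 1) s := by
  induction t generalizing s with
  | zero => exact label_le_subtreeCost G H θ 1 s
  | succ t ih =>
    change _ + _ ≤ _ + _
    gcongr with s' _
    exact ih s'

/-- Subtrees at distinct vertices of the same level are disjoint. -/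
theorem sum_subtreeCost_le (t l : ℕ) :
    ∑ s : ForestVertex n L with s.1.length = l, subtreeCost G H θ t s ≤
      ∑ s : ForestVertex n L with l ≤ s.1.length, ‖forestLabel G s - forestLabel H (θ s)‖ := by
  classical
  induction t generalizing l with
  | zero =>
    refine Finset.sum_le_sum_of_subset_of_nonneg (fun s => ?_) fun _ _ _ => norm_nonneg _
    simp only [Finset.mem_filter, Finset.mem_univ, true_and]
    omega
  | succ t ih =>
    have hsplit : (Finset.univ.filter fun s : ForestVertex n L => l ≤ s.1.length) =
        (Finset.univ.filter fun s : ForestVertex n L => s.1.length = l) ∪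
          Finset.univ.filter fun s : ForestVertex n L => l + 1 ≤ s.1.length := by
      ext s
      simp only [Finset.mem_filter, Finset.mem_univ, true_and, Finset.mem_union]
      omega
    have hdisj : Disjoint (Finset.univ.filter fun s : ForestVertex n L => s.1.length = l)
        (Finset.univ.filter fun s : ForestVertex n L => l + 1 ≤ s.1.length) := by
      rw [Finset.disjoint_filter]
      intros
      omega
    rw [hsplit, Finset.sum_union hdisj]
    simp only [subtreeCost, Finset.sum_add_distrib]
    -- The children of the vertices of length `l` have length `l + 1`, and none is counted twice
    -- since a list determines its tail.
    refine add_le_add le_rfl (le_trans ?_ (ih (l + 1)))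
    rw [← Finset.sum_biUnion]
    · refine Finset.sum_le_sum_of_subset_of_nonneg (fun s => ?_)
        fun _ _ _ => subtreeCost_nonneg G H θ t _
      simp only [Finset.mem_biUnion, Finset.mem_filter, Finset.mem_univ, true_and]
      rintro ⟨p, hp, v, hv⟩
      simp [hv, hp]
    · intro p _ p' _ hne
      refine Finset.disjoint_filter.2 fun s _ hs hs' => hne ?_
      obtain ⟨v, hv⟩ := hs
      obtain ⟨v', hv'⟩ := hs'
      rw [hv, List.cons.injEq] at hv'
      exact Subtype.ext hv'.2

theorem sum_roots_subtreeCost_le (t : ℕ) :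
    ∑ s : ForestVertex n L with s.1.length = 1, subtreeCost G H θ t s ≤ forestCost G H θ :=
  (sum_subtreeCost_le G H θ t 1).trans
    (Finset.sum_le_sum_of_subset_of_nonneg (Finset.filter_subset _ _) fun _ _ _ => norm_nonneg _)

/-- The sum over the children of a vertex is reindexed by an edge-preserving bijection. -/
theorem sum_children_apply {E : Type*} [AddCommMonoid E] (f : ForestVertex n L → E)
    (s : ForestVertex n L) [DecidablePred fun s' => ForestChild s' s]
    [DecidablePred fun s' => ForestChild s' (θ s)] :
    ∑ s' with ForestChild s' (θ s), f s' = ∑ s' with ForestChild s' s, f (θ s') := by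
  symm
  refine Finset.sum_bij (fun s' _ => θ s') ?_ ?_ ?_ ?_
  · intro s' hs'
    simpa [θ.map_rel_iff] using hs'
  · intro a _ b _ h
    exact θ.injective h
  · intro b hb
    refine ⟨θ.symm b, ?_, by simp⟩
    simp only [Finset.mem_filter, Finset.mem_univ, true_and] at hb ⊢
    rw [← θ.map_rel_iff]
    simpa using hb
  · intros; rfl

/-- The sum over the children of a vertex of a function supported on the walks. -/
theorem sum_children_walk {E : Type*} [AddCommMonoid E] (g : Fin n → E) (s : ForestVertex n L)
    (hs : s.1.IsChain G.graph.Adj) (hlen : s.1.length ≤ L)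
    [DecidablePred fun s' => ForestChild s' s] [DecidablePred fun s' : ForestVertex n L =>
      s'.1.IsChain G.graph.Adj] [DecidablePred fun u => G.graph.Adj (s.1.head s.2.1) u] :
    ∑ s' with ForestChild s' s,
        (if s'.1.IsChain G.graph.Adj then g (s'.1.head s'.2.1) else 0) =
      ∑ u with G.graph.Adj (s.1.head s.2.1) u, g u := by
  rw [← Finset.sum_filter, Finset.filter_filter]
  obtain ⟨_ | ⟨v, l⟩, h0, h1, h2⟩ := s
  · exact absurd rfl h0
  symm
  have hadj : ∀ u, G.graph.Adj v u → G.graph.Adj u v := fun u h => h.symm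
  -- A neighbour `u` corresponds to the walk prolonged by `u`. It is a forest vertex because
  -- adjacent vertices are distinct and `s` lies above the last level.
  refine Finset.sum_bij (fun u hu => (⟨u :: v :: l, by simp, by simpa using hlen,
    List.isChain_cons_cons.2 ⟨(hadj u (Finset.mem_filter.1 hu).2).ne, h2⟩⟩ : ForestVertex n L)) ?_ ?_ ?_ ?_
  · intro u hu
    exact Finset.mem_filter.2 ⟨Finset.mem_univ _, ⟨u, rfl⟩,
      List.isChain_cons_cons.2 ⟨hadj u (Finset.mem_filter.1 hu).2, hs⟩⟩
  · intro u _ u' _ h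
    exact (List.cons.inj (congrArg Subtype.val h)).1
  · rintro ⟨b, hb0, hb1, hb2⟩ hb
    obtain ⟨⟨u, hu⟩, hw⟩ := (Finset.mem_filter.1 hb).2
    simp only at hu
    subst hu
    exact ⟨u, Finset.mem_filter.2 ⟨Finset.mem_univ _, (List.isChain_cons_cons.1 hw).1.symm⟩, rfl⟩
  · intros; rfl

/-- The sum over the roots. -/
theorem sum_roots {E : Type*} [AddCommMonoid E] (g : Fin n → E) :
    ∑ s : ForestVertex n L with s.1.length = 1, g (s.1.head s.2.1) = ∑ v, g v := by
  symm
  refine Finset.sum_bij (fun v _ => (⟨[v], by simp, by simp, by simp⟩ : ForestVertex n L))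
    ?_ ?_ ?_ ?_
  · intro v _
    exact Finset.mem_filter.2 ⟨Finset.mem_univ _, rfl⟩
  · intro u _ u' _ h
    simpa using congrArg Subtype.val h
  · rintro ⟨b, hb0, hb1, hb2⟩ hb
    obtain ⟨u, rfl⟩ := List.length_eq_one_iff.1 (Finset.mem_filter.1 hb).2
    exact ⟨u, by simp, rfl⟩
  · intros; rfl

end Forest

section RowMul

variable {m k : ℕ} (W : Matrix (Fin m) (Fin k) ℝ)

theorem rowMul_zero : rowMul W 0 = 0 := by
  simp [rowMul]

theorem norm_rowMul_sub_le {ω : ℝ≥0} (h : LipschitzWith ω (rowMul W))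
    (x y : EuclideanSpace ℝ (Fin m)) : ‖rowMul W x - rowMul W y‖ ≤ ω * ‖x - y‖ := by
  simpa [dist_eq_norm] using h.dist_le_mul x y

end RowMul

/-! ### Network features on the padded forest -/

namespace SumMPNN

variable {n d L : ℕ} (N : SumMPNN L d) (G H : AttrGraph n d)
  (θ : @ForestChild n L ≃r @ForestChild n L)

open Classical in
/-- The feature of the last vertex of a walk, and `0` for padding vertices. -/
noncomputable def walkFeature (t : ℕ) (s : ForestVertex n L) :
    EuclideanSpace ℝ (Fin (layerDim d N.width t)) :=
  if s.1.IsChain G.graph.Adj then N.feature G t (s.1.head s.2.1) else 0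

open Classical in
/-- The argument of the non-linear map of layer `t` at a vertex of the forest. -/
noncomputable def preactivation (t : ℕ) (s : ForestVertex n L) :
    EuclideanSpace ℝ (Fin (N.width t)) :=
  rowMul (N.W₁ t) (N.walkFeature G t s) +
    ∑ s' with ForestChild s' s, rowMul (N.W₂ t) (N.walkFeature G t s')

theorem walkFeature_of_walk {s : ForestVertex n L} (hs : s.1.IsChain G.graph.Adj) (t : ℕ) :
    N.walkFeature G t s = N.feature G t (s.1.head s.2.1) := if_pos hs

theorem walkFeature_of_not_walk {s : ForestVertex n L} (hs : ¬ s.1.IsChain G.graph.Adj) (t : ℕ) :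
    N.walkFeature G t s = 0 := if_neg hs

/-- Padding children carry the feature `0` and hence send no message, so the sum over forest
children is the sum over neighbours. Vertices of length `L + 1` are excluded because they have no
children. -/
theorem walkFeature_succ_of_walk {s : ForestVertex n L} (hs : s.1.IsChain G.graph.Adj)
    (hlen : s.1.length ≤ L) (t : ℕ) :
    N.walkFeature G (t + 1) s = N.φ t (N.preactivation G t s) := by
  classical
  rw [walkFeature_of_walk N G hs, preactivation, walkFeature_of_walk N G hs]
  change N.φ t (_ + ∑ u with G.graph.Adj (s.1.head s.2.1) u, _) = _
  rw [← sum_children_walk G (fun u => rowMul (N.W₂ t) (N.feature G t u)) s hs hlen]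
  congr 2
  refine Finset.sum_congr rfl fun s' _ => ?_
  unfold walkFeature
  split_ifs
  · rfl
  · rw [rowMul_zero]

/-- No extension of a non-walk is a walk. Applying `φ_t` here would give `φ_t(0)`, whereas the walk
feature is `0`; this gap is the source of the `β` terms. -/
theorem preactivation_of_not_walk {s : ForestVertex n L} (hs : ¬ s.1.IsChain G.graph.Adj) (t : ℕ) :
    N.preactivation G t s = 0 := by
  classical
  rw [preactivation, walkFeature_of_not_walk N G hs, rowMul_zero, zero_add]
  refine Finset.sum_eq_zero fun s' hs' => ?_
  obtain ⟨v, hv⟩ := (Finset.mem_filter.1 hs').2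
  rw [walkFeature_of_not_walk, rowMul_zero]
  rw [hv]
  exact fun h => hs h.tail

/-- Since `θ` maps the children of `s` onto those of `θ s`, the messages can be compared term by
term. The children's costs at depth `t` add up to at most the cost of `s` at depth `t + 1`, which
also dominates the vertex's own term. -/
theorem norm_preactivation_sub_le {ω₁ ω₂ : ℝ≥0} {t : ℕ} {c : ℝ} {s : ForestVertex n L}
    (h₁ : LipschitzWith ω₁ (rowMul (N.W₁ t))) (h₂ : LipschitzWith ω₂ (rowMul (N.W₂ t)))
    (hc : 0 ≤ c)
    (hs : ‖N.walkFeature G t s - N.walkFeature H t (θ s)‖ ≤ c * subtreeCost G H θ t s)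
    (hs' : ∀ s', ForestChild s' s →
      ‖N.walkFeature G t s' - N.walkFeature H t (θ s')‖ ≤ c * subtreeCost G H θ t s') :
    ‖N.preactivation G t s - N.preactivation H t (θ s)‖ ≤
      (ω₁ + ω₂) * c * subtreeCost G H θ (t + 1) s := by
  classical
  have e₁ : ‖rowMul (N.W₁ t) (N.walkFeature G t s) -
      rowMul (N.W₁ t) (N.walkFeature H t (θ s))‖ ≤
      ω₁ * (c * subtreeCost G H θ (t + 1) s) := by
    refine (norm_rowMul_sub_le _ h₁ _ _).trans ?_
    gcongr
    exact hs.trans (mul_le_mul_of_nonneg_left (subtreeCost_le_succ G H θ t s) hc)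
  have e₂ : ‖∑ s' with ForestChild s' s, rowMul (N.W₂ t) (N.walkFeature G t s') -
      ∑ s' with ForestChild s' (θ s), rowMul (N.W₂ t) (N.walkFeature H t s')‖ ≤
      ω₂ * (c * subtreeCost G H θ (t + 1) s) := by
    rw [sum_children_apply, ← Finset.sum_sub_distrib]
    refine (norm_sum_le _ _).trans ?_
    have hD : ∑ s' with ForestChild s' s, subtreeCost G H θ t s' ≤
        subtreeCost G H θ (t + 1) s := le_add_of_nonneg_left (norm_nonneg _)
    refine le_trans (Finset.sum_le_sum (g := fun s' => ω₂ * (c * subtreeCost G H θ t s'))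
      fun s' hs₁ => ?_) ?_
    · refine (norm_rowMul_sub_le _ h₂ _ _).trans ?_
      gcongr
      exact hs' s' (Finset.mem_filter.1 hs₁).2
    · rw [← Finset.mul_sum, ← Finset.mul_sum]
      gcongr
  unfold preactivation
  rw [add_sub_add_comm]
  refine (norm_add_le _ _).trans ((add_le_add e₁ e₂).trans_eq (by ring))

end SumMPNN

/-! ### Propagation of the bound through the layers -/

/-- The Lipschitz constant, with respect to the cost of the subtree, of the features after `t`
layers. -/
noncomputable def LayerBounds.featureConst {L : ℕ} (B : LayerBounds L) : ℕ → ℝ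
  | 0 => 1
  -- The summand `β` pays for walks matched with padding. The value `0` beyond layer `L` plays no
  -- role.
  | t + 1 => if h : t < L then
      B.Lφ ⟨t, h⟩ * ((B.ω₁ ⟨t, h⟩ + B.ω₂ ⟨t, h⟩) * B.featureConst t) + B.β ⟨t, h⟩ else 0

theorem LayerBounds.featureConst_nonneg {L : ℕ} (B : LayerBounds L) (t : ℕ) :
    0 ≤ B.featureConst t := by
  induction t with
  | zero => exact zero_le_one
  | succ t ih =>
    rw [featureConst]
    split_ifs <;> positivity

namespace SumMPNN

variable {n d L q : ℕ} (N : SumMPNN L d) {G H : AttrGraph n d}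
  (θ : @ForestChild n L ≃r @ForestChild n L)

theorem norm_attr {G : AttrGraph n d} (hG : G ∈ boundedGraphs n d q) (v : Fin n) :
    ‖G.attr v‖ = 1 := by
  obtain ⟨i, hi⟩ := hG.1 v
  rw [hi]
  simp

/-- The length condition guarantees that the forest still has `t` levels below `s`, so that all
messages used are present. -/
theorem norm_walkFeature_sub_le {B : LayerBounds L}
    (hN : ∀ t : Fin L, LipschitzWith (B.Lφ t) (N.φ t) ∧ LipschitzWith (B.ω₁ t) (rowMul (N.W₁ t)) ∧
      LipschitzWith (B.ω₂ t) (rowMul (N.W₂ t)) ∧ ‖N.φ t 0‖ ≤ B.β t)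
    (hG : G ∈ boundedGraphs n d q) (hH : H ∈ boundedGraphs n d q) (t : ℕ)
    (s : ForestVertex n L) (hs : s.1.length + t ≤ L + 1) :
    ‖N.walkFeature G t s - N.walkFeature H t (θ s)‖ ≤
      B.featureConst t * subtreeCost G H θ t s := by
  induction t generalizing s with
  | zero =>
    rw [LayerBounds.featureConst, one_mul]
    exact le_rfl
  | succ t ih =>
    have htL : t < L := by have := s.length_pos; omega
    have hlen : s.1.length ≤ L := by omega
    have hlen' : (θ s).1.length ≤ L := by rwa [ForestVertex.length_apply]
    obtain ⟨hφ, h₁, h₂, h0⟩ := hN ⟨t, htL⟩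
    have hpre := N.norm_preactivation_sub_le G H θ h₁ h₂ (B.featureConst_nonneg t)
      (ih s (by omega)) (s := s) fun s' ⟨v, hv⟩ => ih s' (by rw [hv, List.length_cons]; omega)
    have hD := subtreeCost_nonneg G H θ (t + 1) s
    have hφ' : ‖N.φ t (N.preactivation G t s) - N.φ t (N.preactivation H t (θ s))‖ ≤
        B.Lφ ⟨t, htL⟩ * ((B.ω₁ ⟨t, htL⟩ + B.ω₂ ⟨t, htL⟩) * B.featureConst t *
          subtreeCost G H θ (t + 1) s) := by
      have := hφ.dist_le_mul (N.preactivation G t s) (N.preactivation H t (θ s))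
      rw [dist_eq_norm, dist_eq_norm] at this
      exact this.trans (by gcongr)
    have hlab := label_le_subtreeCost G H θ (t + 1) s
    rw [LayerBounds.featureConst, dif_pos htL, add_mul]
    by_cases hsG : s.1.IsChain G.graph.Adj <;> by_cases hsH : (θ s).1.IsChain H.graph.Adj
    · rw [walkFeature_succ_of_walk N G hsG hlen, walkFeature_succ_of_walk N H hsH hlen']
      refine hφ'.trans ?_
      have : (0 : ℝ) ≤ B.β ⟨t, htL⟩ * subtreeCost G H θ (t + 1) s := by positivity
      linarith
    · rw [walkFeature_of_not_walk N H hsH, sub_zero, walkFeature_succ_of_walk N G hsG hlen]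
      rw [preactivation_of_not_walk N H hsH] at hφ'
      -- A one-hot label against `0`: the subtree cost is at least `1`, so `β` is at most `β` times
      -- that cost.
      rw [forestLabel, if_pos hsG, forestLabel, if_neg hsH, sub_zero, norm_attr hG] at hlab
      have h3 := norm_le_norm_sub_add (N.φ t (N.preactivation G t s)) (N.φ t 0)
      have h4 : (B.β ⟨t, htL⟩ : ℝ) ≤ B.β ⟨t, htL⟩ * subtreeCost G H θ (t + 1) s :=
        le_mul_of_one_le_right (B.β ⟨t, htL⟩).2 hlab
      refine h3.trans ?_
      simp only at h0
      linarith
    · rw [walkFeature_of_not_walk N G hsG, zero_sub, norm_neg,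
        walkFeature_succ_of_walk N H hsH hlen']
      rw [preactivation_of_not_walk N G hsG, norm_sub_rev] at hφ'
      rw [forestLabel, if_neg hsG, forestLabel, if_pos hsH, zero_sub, norm_neg,
        norm_attr hH] at hlab
      have h3 := norm_le_norm_sub_add (N.φ t (N.preactivation H t (θ s))) (N.φ t 0)
      have h4 : (B.β ⟨t, htL⟩ : ℝ) ≤ B.β ⟨t, htL⟩ * subtreeCost G H θ (t + 1) s :=
        le_mul_of_one_le_right (B.β ⟨t, htL⟩).2 hlab
      refine h3.trans ?_
      simp only at h0
      linarith
    · rw [walkFeature_of_not_walk N G hsG, walkFeature_of_not_walk N H hsH, sub_zero, norm_zero]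
      have := B.featureConst_nonneg t
      positivity

theorem walkFeature_root (G : AttrGraph n d) (t : ℕ) {s : ForestVertex n L}
    (hs : s.1.length = 1) : N.walkFeature G t s = N.feature G t (s.1.head s.2.1) := by
  refine N.walkFeature_of_walk G ?_ t
  obtain ⟨u, hu⟩ := List.length_eq_one_iff.1 hs
  rw [hu]
  exact List.isChain_singleton u

theorem norm_sum_feature_sub_le {B : LayerBounds L}
    (hN : ∀ t : Fin L, LipschitzWith (B.Lφ t) (N.φ t) ∧ LipschitzWith (B.ω₁ t) (rowMul (N.W₁ t)) ∧
      LipschitzWith (B.ω₂ t) (rowMul (N.W₂ t)) ∧ ‖N.φ t 0‖ ≤ B.β t)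
    (hG : G ∈ boundedGraphs n d q) (hH : H ∈ boundedGraphs n d q) :
    ‖∑ v, N.feature G L v - ∑ v, N.feature H L v‖ ≤ B.featureConst L * forestDist L G H := by
  obtain ⟨θ, hθ⟩ := exists_forestDist_eq L G H
  -- As `θ` preserves levels it permutes the roots, so the sum for `H` may be read along `θ`.
  have hroots : ∑ v, N.feature H L v =
      ∑ s : ForestVertex n L with s.1.length = 1, N.walkFeature H L (θ s) := by
    rw [← sum_roots (L := L)]
    symm
    refine Finset.sum_bij (fun s _ => θ s) ?_ (fun a _ b _ h => θ.injective h) ?_ ?_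
    · intro s hs
      simpa [ForestVertex.length_apply] using hs
    · intro b hb
      refine ⟨θ.symm b, ?_, by simp⟩
      simpa [ForestVertex.length_apply] using hb
    · intro s hs
      refine N.walkFeature_root H L ?_
      rw [ForestVertex.length_apply]
      exact (Finset.mem_filter.1 hs).2
  rw [hroots, ← sum_roots (L := L), ← Finset.sum_sub_distrib, ← hθ]
  refine (norm_sum_le _ _).trans ?_
  refine le_trans ?_ (mul_le_mul_of_nonneg_left (sum_roots_subtreeCost_le G H θ L)
    (B.featureConst_nonneg L))
  rw [Finset.mul_sum]
  refine Finset.sum_le_sum fun s hs => ?_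
  have hs1 := (Finset.mem_filter.1 hs).2
  rw [← N.walkFeature_root G L hs1]
  exact N.norm_walkFeature_sub_le θ hN hG hH L s (by omega)

end SumMPNN

/-- The maps of the class are Lipschitz with respect to the Forest distance. -/
theorem abs_sub_le_of_mem_sumMPNNClass {L n d q : ℕ} {B : LayerBounds L} {σ : ℝ → ℝ}
    {Lψ LF : ℝ≥0} {M' : ℝ} {h : BoundedGraph n d q → ℝ}
    (hh : h ∈ sumMPNNClass L B σ Lψ LF M' n d q) (G H : BoundedGraph n d q) :
    |h G - h H| ≤ LF * (Lψ * (1 / n * (B.featureConst L * forestDist L G.1 H.1))) := by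
  obtain ⟨N, hN, hψ, hF, -, rfl⟩ := hh
  have h1 := hF.dist_le_mul (N.readout G.1) (N.readout H.1)
  have h2 := hψ.dist_le_mul ((1 / (n : ℝ)) • ∑ v, N.feature G.1 L v)
    ((1 / (n : ℝ)) • ∑ v, N.feature H.1 L v)
  have h3 := N.norm_sum_feature_sub_le hN G.2 H.2
  rw [Real.dist_eq] at h1
  refine h1.trans (mul_le_mul_of_nonneg_left (h2.trans ?_) LF.2)
  rw [dist_eq_norm, ← smul_sub, norm_smul, Real.norm_of_nonneg (by positivity)]
  gcongr

/-! ### Generalization from robustness -/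

section Concentration

theorem sum_comp_eq_sum_card_fiber {ι : Type*} [Fintype ι] [DecidableEq ι] (m : ℕ) (S : Fin m → ι) (e : ι → ℝ) :
    ∑ j, e (S j) = ∑ i, e i * (Finset.univ.filter fun j => S j = i).card := by
  rw [← Finset.sum_fiberwise Finset.univ S]
  refine Finset.sum_congr rfl fun i _ => ?_
  rw [Finset.sum_congr rfl (g := fun _ => e i) fun j hj => by rw [(Finset.mem_filter.1 hj).2]]
  rw [Finset.sum_const, nsmul_eq_mul, mul_comm]

variable {Z ι : Type*} [MeasurableSpace Z] [Fintype ι] [MeasurableSpace ι]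
  [DiscreteMeasurableSpace ι]

theorem integral_comp_eq_sum (μ : Measure Z) [IsProbabilityMeasure μ] {f : Z → ι}
    (hf : Measurable f) (e : ι → ℝ) : ∫ z, e (f z) ∂μ = ∑ i, e i * μ.real (f ⁻¹' {i}) := by
  have := Measure.isProbabilityMeasure_map (μ := μ) hf.aemeasurable
  rw [← integral_map hf.aemeasurable (by fun_prop), integral_fintype (Integrable.of_finite)]
  refine Finset.sum_congr rfl fun i _ => ?_
  rw [map_measureReal_apply hf (measurableSet_singleton i), smul_eq_mul, mul_comm]

/-- **Hoeffding's inequality** for independent draws of a function with values in `[-1, 1]`. -/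
theorem measureReal_pi_sum_sub_integral_ge_le (μ : Measure Z) [IsProbabilityMeasure μ] {g : Z → ℝ}
    (hg : Measurable g) (hb : ∀ z, g z ∈ Icc (-1 : ℝ) 1) (m : ℕ) {r : ℝ} (hr : 0 ≤ r) :
    (Measure.pi fun _ : Fin m => μ).real {S | r ≤ ∑ j, (g (S j) - ∫ z, g z ∂μ)} ≤
      Real.exp (-r ^ 2 / (2 * m)) := by
  have hX : ProbabilityTheory.HasSubgaussianMGF (fun z => g z - ∫ z, g z ∂μ)
      ((‖(1 : ℝ) - -1‖₊ / 2) ^ 2) μ :=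
    ProbabilityTheory.hasSubgaussianMGF_of_mem_Icc hg.aemeasurable (.of_forall hb)
  -- The interval has length `2`, so the sub-Gaussian variance proxy is `1`.
  have hc : (‖(1 : ℝ) - -1‖₊ / 2) ^ 2 = 1 := by
    ext
    norm_num
  rw [hc] at hX
  have hind := ProbabilityTheory.iIndepFun_pi (μ := fun _ : Fin m => μ)
    (X := fun _ z => g z - ∫ z, g z ∂μ) fun _ => (hg.sub_const _).aemeasurable
  have key := ProbabilityTheory.HasSubgaussianMGF.measure_sum_ge_le_of_iIndepFun hind
    (c := fun _ => 1) (s := Finset.univ) (fun j _ => ?_) hr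
  · simpa using key
  · refine ProbabilityTheory.HasSubgaussianMGF.of_map (Y := fun S : Fin m → Z => S j)
      (X := fun z => g z - ∫ z, g z ∂μ) (measurable_pi_apply j).aemeasurable ?_
    rwa [(measurePreserving_eval (fun _ : Fin m => μ) j).map_eq]

variable [DecidableEq ι]

/-- The **Bretagnolle–Huber–Carol inequality**: concentration of the empirical frequencies of the
cells of a finite partition. -/
theorem measureReal_pi_sum_abs_freq_sub_gt_le (μ : Measure Z) [IsProbabilityMeasure μ] {f : Z → ι}
    (hf : Measurable f) {m : ℕ} (hm : 0 < m) {r : ℝ} (hr : 0 ≤ r) :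
    (Measure.pi fun _ : Fin m => μ).real
        {S | r < ∑ i, |μ.real (f ⁻¹' {i}) -
          ((Finset.univ.filter fun j => f (S j) = i).card : ℝ) / m|} ≤
      2 ^ Fintype.card ι * Real.exp (-(m * r ^ 2) / 2) := by
  have hm' : (0 : ℝ) < m := by exact_mod_cast hm
  let sgn : Finset ι → ι → ℝ := fun A i => if i ∈ A then 1 else -1
  have hsgn : ∀ A i, sgn A i ∈ Icc (-1 : ℝ) 1 := by
    intro A i
    simp only [sgn]
    split_ifs <;> norm_num
  have hmeas : ∀ A, Measurable fun z => sgn A (f z) := fun A =>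
    (Measurable.of_discrete (f := sgn A)).comp hf
  have hsub : {S : Fin m → Z | r < ∑ i, |μ.real (f ⁻¹' {i}) -
          ((Finset.univ.filter fun j => f (S j) = i).card : ℝ) / m|} ⊆
      ⋃ A ∈ (Finset.univ : Finset (Finset ι)),
        {S | m * r ≤ ∑ j, (sgn A (f (S j)) - ∫ z, sgn A (f z) ∂μ)} := by
    intro S hS
    let a : ι → ℝ := fun i => ((Finset.univ.filter fun j => f (S j) = i).card : ℝ) / m -
      μ.real (f ⁻¹' {i})
    -- An `ℓ¹` norm is attained at a sign vector, here the signs of the deviations `a`. The event is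
    -- thus covered by one Hoeffding event per subset of `ι`, which gives the factor `2 ^ card ι`.
    refine mem_biUnion (x := Finset.univ.filter fun i => 0 ≤ a i)
      (Finset.mem_coe.2 (Finset.mem_univ _)) ?_
    set A := Finset.univ.filter fun i => 0 ≤ a i with hA
    have habs : ∀ i, |μ.real (f ⁻¹' {i}) -
        ((Finset.univ.filter fun j => f (S j) = i).card : ℝ) / m| = sgn A i * a i := by
      intro i
      rw [abs_sub_comm]
      change |a i| = _
      by_cases h : 0 ≤ a i
      · simp [sgn, hA, h, abs_of_nonneg h]
      · simp [sgn, hA, h, abs_of_neg (not_le.1 h)]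
    have hsum : ∑ j, (sgn A (f (S j)) - ∫ z, sgn A (f z) ∂μ) = m * ∑ i, sgn A i * a i := by
      rw [Finset.sum_sub_distrib, Finset.sum_const, Finset.card_univ, Fintype.card_fin,
        nsmul_eq_mul, integral_comp_eq_sum μ hf, sum_comp_eq_sum_card_fiber m (fun j => f (S j)),
        Finset.mul_sum, Finset.mul_sum, ← Finset.sum_sub_distrib]
      refine Finset.sum_congr rfl fun i _ => ?_
      simp only [a]
      field_simp
    simp only [mem_ofPred_eq, habs] at hS
    rw [mem_ofPred_eq, hsum]
    exact mul_le_mul_of_nonneg_left hS.le hm'.le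
  refine (measureReal_mono hsub (measure_ne_top _ _)).trans ((measureReal_biUnion_finset_le _ _).trans ?_)
  refine (Finset.sum_le_sum fun A _ => measureReal_pi_sum_sub_integral_ge_le μ (hmeas A)
    (fun z => hsgn A _) m (by positivity)).trans_eq ?_
  rw [Finset.sum_const, Finset.card_univ, Fintype.card_finset, nsmul_eq_mul]
  push_cast
  congr 2
  field_simp

/-- If the oscillation of `g` on each cell of a partition is at most `η`, its mean differs from an
empirical mean by at most `η`, up to the deviation of the empirical frequencies of the cells. -/
theorem abs_integral_sub_mean_le (μ : Measure Z) [IsProbabilityMeasure μ] {f : Z → ι}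
    (hf : Measurable f) (hsurj : Function.Surjective f) {g : Z → ℝ} (hg : Integrable g μ)
    {M η : ℝ} (hM : ∀ z, |g z| ≤ M) (hη : ∀ z z', f z = f z' → |g z - g z'| ≤ η) {m : ℕ}
    (hm : 0 < m) (S : Fin m → Z) :
    |∫ z, g z ∂μ - 1 / m * ∑ j, g (S j)| ≤ η + M * ∑ i, |μ.real (f ⁻¹' {i}) -
      ((Finset.univ.filter fun j => f (S j) = i).card : ℝ) / m| := by
  have hm' : (0 : ℝ) < m := by exact_mod_cast hm
  -- `e` is the mean of `g` over the cell, or any value of `g` there if the cell is null. The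
  -- integral of `g` is then reproduced exactly, so `η` is lost only once, in the empirical mean.
  have hcell : ∀ i, ∃ e : ℝ, |e| ≤ M ∧ (∀ z, f z = i → |e - g z| ≤ η) ∧
      e * μ.real (f ⁻¹' {i}) = ∫ z in f ⁻¹' {i}, g z ∂μ := by
    intro i
    have hmeas : MeasurableSet (f ⁻¹' {i}) := hf (measurableSet_singleton i)
    by_cases h0 : μ.real (f ⁻¹' {i}) = 0
    · obtain ⟨z, hz⟩ := hsurj i
      refine ⟨g z, hM z, fun z' hz' => hη z z' (hz.trans hz'.symm), ?_⟩
      rw [h0, mul_zero, setIntegral_measure_zero]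
      exact (measureReal_eq_zero_iff).1 h0
    · have hpos : 0 < μ.real (f ⁻¹' {i}) := lt_of_le_of_ne measureReal_nonneg (Ne.symm h0)
      refine ⟨(∫ z in f ⁻¹' {i}, g z ∂μ) / μ.real (f ⁻¹' {i}), ?_, fun z hz => ?_,
        div_mul_cancel₀ _ h0⟩
      · rw [abs_div, abs_of_pos hpos, div_le_iff₀ hpos, ← Real.norm_eq_abs]
        exact norm_setIntegral_le_of_norm_le_const (measure_lt_top _ _) fun z _ => hM z
      · have e : (∫ z in f ⁻¹' {i}, g z ∂μ) / μ.real (f ⁻¹' {i}) - g z =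
            (∫ x in f ⁻¹' {i}, (g x - g z) ∂μ) / μ.real (f ⁻¹' {i}) := by
          rw [integral_sub hg.integrableOn (integrable_const _), setIntegral_const, smul_eq_mul]
          field_simp
        rw [e, abs_div, abs_of_pos hpos, div_le_iff₀ hpos, ← Real.norm_eq_abs]
        exact norm_setIntegral_le_of_norm_le_const (measure_lt_top _ _)
          fun x hx => hη x z (Eq.trans hx hz.symm)
  choose e heM heη hep using hcell
  have hint : ∫ z, g z ∂μ = ∑ i, e i * μ.real (f ⁻¹' {i}) := by
    have hU : (⋃ i, f ⁻¹' {i}) = univ := by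
      ext z
      simp
    rw [← setIntegral_univ, ← hU, integral_iUnion_fintype
      (fun i => hf (measurableSet_singleton i)) ?_ fun i => hg.integrableOn]
    · simp only [hep]
    · intro i j hij
      exact Disjoint.preimage f (by simpa using hij)
  have hemp : (1 : ℝ) / m * ∑ j, e (f (S j)) =
      ∑ i, e i * (((Finset.univ.filter fun j => f (S j) = i).card : ℝ) / m) := by
    rw [sum_comp_eq_sum_card_fiber m (fun j => f (S j)), Finset.mul_sum]
    refine Finset.sum_congr rfl fun i _ => ?_
    ring
  have h1 : |1 / (m : ℝ) * ∑ j, e (f (S j)) - 1 / m * ∑ j, g (S j)| ≤ η := by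
    rw [← mul_sub, ← Finset.sum_sub_distrib, abs_mul, abs_of_pos (by positivity)]
    have : |∑ j, (e (f (S j)) - g (S j))| ≤ m * η := by
      refine (Finset.abs_sum_le_sum_abs _ _).trans
        ((Finset.sum_le_sum fun j _ => heη _ (S j) rfl).trans_eq ?_)
      simp
    calc 1 / (m : ℝ) * |∑ j, (e (f (S j)) - g (S j))| ≤ 1 / m * (m * η) := by gcongr
      _ = η := by field_simp
  have h2 : |∫ z, g z ∂μ - 1 / (m : ℝ) * ∑ j, e (f (S j))| ≤ M * ∑ i, |μ.real (f ⁻¹' {i}) -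
      ((Finset.univ.filter fun j => f (S j) = i).card : ℝ) / m| := by
    rw [hint, hemp, ← Finset.sum_sub_distrib, Finset.mul_sum]
    refine (Finset.abs_sum_le_sum_abs _ _).trans (Finset.sum_le_sum fun i _ => ?_)
    rw [← mul_sub, abs_mul]
    exact mul_le_mul_of_nonneg_right (heM i) (abs_nonneg _)
  have := abs_sub_le (∫ z, g z ∂μ) (1 / (m : ℝ) * ∑ j, e (f (S j))) (1 / (m : ℝ) * ∑ j, g (S j))
  linarith

/-- The generalization bound of Xu and Mannor, for hypotheses `g S` that depend on the sample. -/
theorem le_measureReal_pi_abs_integral_sub_mean_le (μ : Measure Z) [IsProbabilityMeasure μ]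
    {f : Z → ι} (hf : Measurable f) (hsurj : Function.Surjective f) {m : ℕ} (hm : 0 < m)
    {g : (Fin m → Z) → Z → ℝ} (hg : ∀ S, Integrable (g S) μ) {M η : ℝ}
    (hM : ∀ S z, |g S z| ≤ M) (hη : ∀ S z z', f z = f z' → |g S z - g S z'| ≤ η)
    {δ : ℝ} (hδ : δ ∈ Ioo (0 : ℝ) 1) :
    1 - δ ≤ (Measure.pi fun _ : Fin m => μ).real
      {S | |∫ z, g S z ∂μ - 1 / m * ∑ j, g S (S j)| ≤ η +
        M * √((Fintype.card ι * (2 * Real.log 2) + 2 * Real.log (1 / δ)) / m)} := by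
  have hm' : (0 : ℝ) < m := by exact_mod_cast hm
  set r := √((Fintype.card ι * (2 * Real.log 2) + 2 * Real.log (1 / δ)) / m) with hr
  have hlog : 0 < Real.log (1 / δ) := Real.log_pos (by rw [lt_div_iff₀ hδ.1]; linarith [hδ.2])
  have hr2 : m * r ^ 2 = Fintype.card ι * (2 * Real.log 2) + 2 * Real.log (1 / δ) := by
    rw [hr, Real.sq_sqrt]
    · field_simp
    · have := Real.log_nonneg one_le_two
      positivity
  have hBHC := measureReal_pi_sum_abs_freq_sub_gt_le μ hf hm (r := r) (Real.sqrt_nonneg _)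
  -- The radius `r` is chosen to make the failure probability exactly `δ`.
  have hval : (2 : ℝ) ^ Fintype.card ι * Real.exp (-(m * r ^ 2) / 2) = δ := by
    have e : -(m * r ^ 2) / 2 = -(Fintype.card ι * Real.log 2) + Real.log δ := by
      rw [hr2, one_div, Real.log_inv]
      ring
    rw [e, Real.exp_add, Real.exp_log hδ.1, Real.exp_neg, ← Real.log_pow,
      Real.exp_log (by positivity)]
    field_simp
  rw [hval] at hBHC
  -- The exceptional event involves only the cells and not `g`, so the dependence of `g S` on the
  -- sample costs nothing.
  have hcover : (univ : Set (Fin m → Z)) ⊆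
      {S | |∫ z, g S z ∂μ - 1 / m * ∑ j, g S (S j)| ≤ η + M * r} ∪
      {S | r < ∑ i, |μ.real (f ⁻¹' {i}) -
          ((Finset.univ.filter fun j => f (S j) = i).card : ℝ) / m|} := by
    intro S _
    by_cases h : r < ∑ i, |μ.real (f ⁻¹' {i}) -
          ((Finset.univ.filter fun j => f (S j) = i).card : ℝ) / m|
    · exact Or.inr h
    · refine Or.inl ?_
      have hM0 : 0 ≤ M := (abs_nonneg _).trans (hM S (S ⟨0, hm⟩))
      refine (abs_integral_sub_mean_le μ hf hsurj (hg S) (hM S) (hη S) hm S).trans ?_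
      gcongr
      exact not_lt.1 h
  have h1 := measureReal_mono (μ := Measure.pi fun _ : Fin m => μ) hcover
  rw [probReal_univ] at h1
  have h2 := measureReal_union_le (μ := Measure.pi fun _ : Fin m => μ)
    {S | |∫ z, g S z ∂μ - 1 / m * ∑ j, g S (S j)| ≤ η + M * r}
    {S | r < ∑ i, |μ.real (f ⁻¹' {i}) -
          ((Finset.univ.filter fun j => f (S j) = i).card : ℝ) / m|}
  linarith

end Concentration

/-! ### The partition given by a minimal cover -/

theorem boundedGraphs_nonempty {n d : ℕ} (q : ℕ) (hd : 0 < d) : (boundedGraphs n d q).Nonempty :=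
  ⟨⟨⊥, fun _ => EuclideanSpace.single ⟨0, hd⟩ 1⟩, fun _ => ⟨⟨0, hd⟩, rfl⟩, fun v => by simp⟩

theorem forestCoveringNumber_pos {n d : ℕ} (q L : ℕ) (hd : 0 < d) (ε : ℝ≥0) :
    0 < forestCoveringNumber n d q L ε := by
  let _ := forestPseudoMetric n d L
  have h := coe_forestCoveringNumber n d q L ε
  have h2 : 0 < coveringNumber ε (boundedGraphs n d q) :=
    coveringNumber_pos_iff.2 (boundedGraphs_nonempty q hd)
  rw [← h] at h2
  exact_mod_cast h2

/-- The graphs can be partitioned into `𝒩(𝒢_{n,d,q}, FD_L, ε)` non-empty cells of diameter at most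
`2ε`. -/
theorem exists_surjective_forestDist_le (n d q L : ℕ) (ε : ℝ≥0) :
    ∃ f : BoundedGraph n d q → Fin (forestCoveringNumber n d q L ε), Function.Surjective f ∧
      ∀ G H, f G = f H → forestDist L G.1 H.1 ≤ 2 * ε := by
  classical
  let _ := forestPseudoMetric n d L
  have hN := coe_forestCoveringNumber n d q L ε
  obtain ⟨C, hC, hfin, hcov, hcard⟩ := exists_set_encard_eq_coveringNumber
    (ε := ε) (A := boundedGraphs n d q) (by rw [← hN]; exact ENat.natCast_ne_top _)
  have hcov' : ∀ G : BoundedGraph n d q, ∃ c : C, edist G.1 c.1 ≤ ε := fun G => by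
    obtain ⟨c, hc, h⟩ := hcov G.2
    exact ⟨⟨c, hc⟩, h⟩
  choose c hc using hcov'
  have hrange : IsCover ε (boundedGraphs n d q) (range fun G => (c G).1) := fun G hG =>
    ⟨_, ⟨⟨G, hG⟩, rfl⟩, hc ⟨G, hG⟩⟩
  have hsub : (range fun G => (c G).1) ⊆ C := by
    rintro _ ⟨G, rfl⟩
    exact (c G).2
  have heq : (range fun G => (c G).1) = C := by
    refine (hfin.subset hsub).eq_of_subset_of_encard_le hsub ?_
    rw [hcard]
    exact hrange.coveringNumber_le_encard (hsub.trans hC)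
  have hsurj : Function.Surjective c := fun x => by
    obtain ⟨G, hG⟩ := heq.symm.subset x.2
    exact ⟨G, Subtype.ext hG⟩
  have : Finite C := hfin
  have hcardC : Nat.card C = forestCoveringNumber n d q L ε := by
    rw [← hN] at hcard
    rw [Nat.card_coe_set_eq, ncard, hcard, ENat.toNat_natCast]
  let e : C ≃ Fin (forestCoveringNumber n d q L ε) := Finite.equivFinOfCardEq hcardC
  refine ⟨e ∘ c, e.surjective.comp hsurj, fun G H h => ?_⟩
  have hGH : c G = c H := e.injective h
  have h1 : dist G.1 (c G).1 ≤ ε := by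
    rw [dist_nndist]
    exact_mod_cast edist_le_coe.1 (hc G)
  have h2 : dist H.1 (c G).1 ≤ ε := by
    rw [dist_nndist, hGH]
    exact_mod_cast edist_le_coe.1 (hc H)
  have h3 := dist_triangle_right G.1 H.1 (c G).1
  change dist G.1 H.1 ≤ _
  linarith

/-! ### The main theorem -/

/-- The loss for the label `1` is not constant. Positivity is needed for the strict inequality in
robustness. -/
theorem crossEntropy_lipschitz_pos {Lℓ : ℝ≥0}
    (h : ∀ y, LipschitzWith Lℓ fun x => crossEntropy x y) : 0 < Lℓ := by
  refine pos_of_ne_zero fun h0 => ?_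
  have h1 := (h 1).dist_le_mul 0 1
  rw [h0, NNReal.coe_zero, zero_mul] at h1
  have h2 : crossEntropy 0 1 = crossEntropy 1 1 := dist_le_zero.1 h1
  have h3 : Real.log (Real.sigmoid 0) = Real.log (Real.sigmoid 1) := by
    simp only [crossEntropy, Fin.val_one, Nat.cast_one] at h2
    linarith
  have h4 := Real.log_injOn_pos (Real.sigmoid_pos 0) (Real.sigmoid_pos 1) h3
  exact zero_ne_one (Real.sigmoid_strictMono.injective h4)

instance (n d q : ℕ) : Finite (BoundedGraph n d q) := (finite_boundedGraphs n d q).to_subtype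

instance (n d q : ℕ) : DiscreteMeasurableSpace (BoundedGraph n d q) := ⟨fun _ => trivial⟩

/-- The oscillation of the loss of a map of the class on a cell of diameter `2ε`. -/
theorem abs_crossEntropy_sub_le {L n d q : ℕ} {B : LayerBounds L} {σ : ℝ → ℝ}
    {Lψ LF Lℓ : ℝ≥0} {M' : ℝ} {ε : ℝ≥0} {h : BoundedGraph n d q → ℝ}
    (hℓ : ∀ y, LipschitzWith Lℓ fun x => crossEntropy x y)
    (hh : h ∈ sumMPNNClass L B σ Lψ LF M' n d q) {G H : BoundedGraph n d q}
    (hGH : forestDist L G.1 H.1 ≤ 2 * ε) (y : Fin 2) :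
    |crossEntropy (h G) y - crossEntropy (h H) y| ≤
      2 / n * Lℓ * LF * (B.featureConst L * Lψ) * ε := by
  have h1 := (hℓ y).dist_le_mul (h G) (h H)
  rw [Real.dist_eq, Real.dist_eq] at h1
  have hc := B.featureConst_nonneg L
  calc |crossEntropy (h G) y - crossEntropy (h H) y|
      ≤ Lℓ * (LF * (Lψ * (1 / n * (B.featureConst L * (2 * ε))))) := by
        refine h1.trans (mul_le_mul_of_nonneg_left
          ((abs_sub_le_of_mem_sumMPNNClass hh G H).trans ?_) Lℓ.2)
        gcongr
    _ = _ := by ring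

theorem mainTheorem7 (L : ℕ) (B : LayerBounds L) (hB : ∀ t, 0 < B.Lφ t) :
    ∃ C : ℝ, 0 < C ∧
      ∀ (σ : ℝ → ℝ) (Lψ LF Lℓ : ℝ≥0) (M' : ℝ) (n d q : ℕ) (ε : ℝ≥0),
        0 < Lψ → 0 < LF → (∀ y, LipschitzWith Lℓ fun x => crossEntropy x y) →
        0 < n → 0 < d → 0 < ε →
        ∀ A : LearningAlgorithm (Fin 2) (sumMPNNClass L B σ Lψ LF M' n d q),
          IsRobust crossEntropy A
            (fun _ => 2 * forestCoveringNumber n d q L ε)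
            (fun _ => Lℓ * LF * forestLipschitzConst B C Lψ * (2 * ε)) ∧
          ∀ (μ : Measure (BoundedGraph n d q × Fin 2)) [IsProbabilityMeasure μ] (M : ℝ),
            (∀ h ∈ sumMPNNClass L B σ Lψ LF M' n d q, ∀ G y, |crossEntropy (h G) y| ≤ M) →
            ∀ m : ℕ, 0 < m → ∀ δ ∈ Ioo (0 : ℝ) 1,
              1 - δ ≤ (Measure.pi fun _ : Fin m => μ).real
                {S | |expError crossEntropy μ (A ⟨m, S⟩ : BoundedGraph n d q → ℝ) -
                      empError crossEntropy S (A ⟨m, S⟩ : BoundedGraph n d q → ℝ)| ≤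
                    2 / n * Lℓ * LF * forestLipschitzConst B C Lψ * ε +
                    M * √((forestCoveringNumber n d q L ε * (4 * Real.log 2) +
                      2 * Real.log (1 / δ)) / m)} := by
  have hP : 0 < ∏ t, (B.Lφ t : ℝ) := Finset.prod_pos fun t _ => hB t
  have hc := B.featureConst_nonneg L
  -- The quotient cancels the product in `forestLipschitzConst`. The added `1` makes `C` positive
  -- even if the feature constant vanishes, and the later comparison of constants strict.
  refine ⟨B.featureConst L / ∏ t, (B.Lφ t : ℝ) + 1, by positivity, ?_⟩
  intro σ Lψ LF Lℓ M' n d q ε hψ hF hℓ hn hd hε A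
  have hℓ0 := crossEntropy_lipschitz_pos hℓ
  have hconst : B.featureConst L * Lψ <
      forestLipschitzConst B (B.featureConst L / ∏ t, (B.Lφ t : ℝ) + 1) Lψ := by
    have hψ' : (0 : ℝ) < Lψ := hψ
    have e : forestLipschitzConst B (B.featureConst L / ∏ t, (B.Lφ t : ℝ) + 1) Lψ =
        B.featureConst L * Lψ + Lψ * ∏ t, (B.Lφ t : ℝ) := by
      rw [forestLipschitzConst]
      field_simp
    rw [e]
    exact lt_add_of_pos_right _ (mul_pos hψ' hP)
  set c' := forestLipschitzConst B (B.featureConst L / ∏ t, (B.Lφ t : ℝ) + 1) Lψ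
  obtain ⟨f, hf, hfd⟩ := exists_surjective_forestDist_le n d q L ε
  let e : Fin 2 × Fin (forestCoveringNumber n d q L ε) ≃
    Fin (2 * forestCoveringNumber n d q L ε) := finProdFinEquiv
  -- Splitting each cell by label doubles the number of cells; within one cell only the graph
  -- varies.
  let F : BoundedGraph n d q × Fin 2 → Fin (2 * forestCoveringNumber n d q L ε) :=
    fun z => e (z.2, f z.1)
  have hFs : Function.Surjective F := fun i => by
    obtain ⟨⟨y, k⟩, rfl⟩ := e.surjective i
    obtain ⟨G, rfl⟩ := hf k
    exact ⟨(G, y), rfl⟩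
  have hosc : ∀ S z z', F z = F z' →
      |crossEntropy ((A S : BoundedGraph n d q → ℝ) z.1) z.2 -
        crossEntropy ((A S : BoundedGraph n d q → ℝ) z'.1) z'.2| ≤
      2 / n * Lℓ * LF * (B.featureConst L * Lψ) * ε := by
    rintro S ⟨G, y⟩ ⟨H, y'⟩ h
    obtain ⟨rfl, hGH⟩ := Prod.mk.inj (e.injective h)
    exact abs_crossEntropy_sub_le hℓ (A S).2 (hfd G H hGH) y
  have hn' : (1 : ℝ) ≤ n := by exact_mod_cast hn
  constructor
  · refine fun S => ⟨mul_pos two_pos (forestCoveringNumber_pos q L hd ε), fun i => F ⁻¹' {i},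
      fun i => hFs i, fun i j hij => Disjoint.preimage F (by simpa using hij), ?_, ?_⟩
    · ext z
      simp
    · intro i z hz z' hz'
      refine (hosc S z z' (Eq.trans hz (Eq.symm hz'))).trans_lt ?_
      have hF' : (0 : ℝ) < LF := hF
      have hε' : (0 : ℝ) < ε := hε
      have hℓ' : (0 : ℝ) < Lℓ := hℓ0
      -- Robustness discards the factor `1 / n`, using `n ≥ 1`; the strictness comes from `hconst`.
      calc 2 / n * Lℓ * LF * (B.featureConst L * Lψ) * ε
          ≤ 2 / 1 * Lℓ * LF * (B.featureConst L * Lψ) * ε := by gcongr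
        _ < 2 / 1 * Lℓ * LF * c' * ε := by gcongr
        _ = Lℓ * LF * c' * (2 * ε) := by ring
  · intro μ _ M hM m hm δ hδ
    have key := le_measureReal_pi_abs_integral_sub_mean_le μ (f := F) Measurable.of_discrete hFs hm
      (g := fun S z => crossEntropy ((A ⟨m, S⟩ : BoundedGraph n d q → ℝ) z.1) z.2)
      (fun S => Integrable.of_finite) (fun S z => hM _ (A ⟨m, S⟩).2 z.1 z.2)
      (fun S => hosc ⟨m, S⟩) hδ
    refine key.trans (measureReal_mono fun S hS => mem_ofPred.2 (le_trans (mem_ofPred.1 hS) ?_))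
    have hlog : (Fintype.card (Fin (2 * forestCoveringNumber n d q L ε)) : ℝ) *
        (2 * Real.log 2) = forestCoveringNumber n d q L ε * (4 * Real.log 2) := by
      rw [Fintype.card_fin]
      push_cast
      ring
    rw [hlog]
    gcongr
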